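/- Let $\mathcal K$ be either the category of commutative rings, where for $A\in\mathcal K$ an $A$-module is a module in the usual sense, or the category of commutative semirings (with $0$ and $1$), where $A$-modules are semimodules, i.e. commutative monoids with an action of $A$. Put $\mathrm{Aff}=\mathcal K^{op}$ and write $\operatorname{Spec} A$ for the object given by $A$. A morphism $\operatorname{Spec}B\to\operatorname{Spec}A$ is a \emph{Zariski open} if $A\to B$ is an epimorphism in $\mathcal K$, is flat (the functor $-\otimes_AB$ from $A$-modules to $B$-modules commutes with finite limits), and is of finite presentation ($\operatorname{Hom}_A(B,-)$ commutes with filtered colimits of commutative $A$-algebras). A family of Zariski opens $\operatorname{Spec}A_i\to\operatorname{Spec}A$ $(i\in I)$ is a \emph{Zariski covering} if for some finite $J\subset I$ the functors $-\otimes_AA_j$ $(j\in J)$ on $A$-modules are jointly conservative. These families generate the Zariski topology on $\mathrm{Aff}$; let $Sh(\mathrm{Aff})$ be the category of sheaves of sets. A subsheaf of an affine $X$ is \emph{open} if it is the sheaf image of $\coprod_i X_i\to X$ for a family of Zariski opens $X_i\to X$ in $\mathrm{Aff}$. A morphism $F\to G$ of sheaves is an \emph{open immersion} if, for every morphism $X\to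 G$ with $X$ affine, $F\times_GX\to X$ is a monomorphism whose image is open in $X$. A \emph{scheme} is a sheaf $F$ that admits a family of open immersions $X_i\to F$ with $X_i$ affine such that $\coprod_iX_i\to F$ is an epimorphism of sheaves; schemes form a full subcategory of $Sh(\mathrm{Aff})$. For commutative rings (resp. commutative semirings) write $\mathrm{Aff}_{\mathbb Z}$ and $\mathbb Z\text{-}Sch$ (resp. $\mathrm{Aff}_{\mathbb N}$ and $\mathbb N\text{-}Sch$) for the resulting categories. The functor $f:\mathrm{Aff}_{\mathbb N}\to\mathrm{Aff}_{\mathbb Z}$, $\operatorname{Spec}A\mapsto\operatorname{Spec}(A\otimes_{\mathbb N}\mathbb Z)$, is continuous for the Zariski topologies (precomposition with $f$ sends sheaves to sheaves). The resulting functor $f^*:Sh(\mathrm{Aff}_{\mathbb Z})\to Sh(\mathrm{Aff}_{\mathbb N})$ has a left adjoint, and this left adjoint sends schemes to schemes. It therefore restricts to a base change functor $$-\otimes_{\mathbb N}\mathbb Z:\ \mathbb N\text{-}Sch\longrightarrow\mathbb Z\text{-}Sch .$$ \textbf{Proposition.} The functor $-\otimes_{\mathbb N}\mathbb Z:\mathbb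 N\text{-}Sch\to\mathbb Z\text{-}Sch$ has a left adjoint $\mathbb Z\text{-}Sch\to\mathbb N\text{-}Sch$, and this left adjoint is fully faithful. Thus $\mathbb Z\text{-}Sch$ embeds in $\mathbb N\text{-}Sch$. -/

import Mathlib

open CategoryTheory Limits Opposite
open scoped TensorProduct

universe u

noncomputable section

namespace RelScheme

/-! ## Schemes relative to a category of "commutative algebras with modules" -/

/-- The data from which relative schemes are built: for every object `A` of a category `K` of
commutative algebras, the category of `A`-modules, and for every morphism `A ⟶ B` in `K`, the
base change functor `- ⊗_A B`. Only the two instances `natModules` (commutative semirings) and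
`intModules` (commutative rings) below are ever used. -/
structure ModuleData (K : Type (u + 1)) [Category.{u} K] where
  /-- The category of modules over an algebra. -/
  Mod : K → Type (u + 1)
  /-- The category structure on modules. -/
  modCategory : ∀ A : K, Category.{u} (Mod A)
  /-- Extension of scalars along a morphism of algebras. -/
  baseChange : ∀ {A B : K}, (A ⟶ B) → (Mod A ⥤ Mod B)

attribute [instance] ModuleData.modCategory

section General

variable {K : Type (u + 1)} [Category.{u} K] (M : ModuleData.{u} K)

/-- `A ⟶ B` is flat if `- ⊗_A B` commutes with finite limits. -/
def IsFlat {A B : K} (φ : A ⟶ B) : Prop :=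
  PreservesFiniteLimits (M.baseChange φ)

/-- `A ⟶ B` is of finite presentation if `Hom_A(B, -)` commutes with (small) filtered colimits
of commutative `A`-algebras. -/
def IsFinPres {A B : K} (φ : A ⟶ B) : Prop :=
  IsFinitelyPresentable.{u} (Under.mk φ)

/-- The morphism of affine schemes `Spec B ⟶ Spec A` corresponding to `A ⟶ B` is a Zariski open
if `A ⟶ B` is a flat epimorphism of finite presentation. Affine schemes are objects of `Kᵒᵖ`. -/
def IsAffineOpen {Y X : Kᵒᵖ} (p : Y ⟶ X) : Prop :=
  Epi p.unop ∧ IsFlat M p.unop ∧ IsFinPres p.unop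

/-- Zariski coverings of affine schemes: families of Zariski opens of `X = Spec A` admitting a
finite subfamily `Spec (A j) ⟶ Spec A` such that the functors `- ⊗_A A j` on `A`-modules are jointly
conservative. -/
def zariskiPrecoverage : Precoverage Kᵒᵖ where
  coverings X := {R | (∀ ⦃Y : Kᵒᵖ⦄ (p : Y ⟶ X), R p → IsAffineOpen M p) ∧
    ∃ (n : ℕ) (Y : Fin n → Kᵒᵖ) (p : ∀ j, Y j ⟶ X), (∀ j, R (p j)) ∧
      ∀ ⦃P Q : M.Mod X.unop⦄ (v : P ⟶ Q),
        (∀ j, IsIso ((M.baseChange (p j).unop).map v)) → IsIso v}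

/-- The Zariski topology on the category `Kᵒᵖ` of affine schemes. -/
def zariskiTopology : GrothendieckTopology Kᵒᵖ :=
  (zariskiPrecoverage M).toGrothendieck

/-- Sheaves of sets on affine schemes for the Zariski topology. -/
abbrev ZarSheaf : Type (u + 1) := Sheaf (zariskiTopology M) (Type u)

/-- The image, in the sense of Zariski sheaves, of the morphism `∐ F i ⟶ G` given by a family of
morphisms `F i ⟶ G`: the sections of `G` that locally lift to one of the `F i`. -/
def sheafImage {ι : Type u} {F : ι → (Kᵒᵖᵒᵖ ⥤ Type u)} {G : Kᵒᵖᵒᵖ ⥤ Type u}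
    (p : ∀ i, F i ⟶ G) : Subfunctor G :=
  (⨆ i, Subfunctor.range (p i)).sheafify (zariskiTopology M)

/-- A subsheaf `F` of an affine scheme `X` is a Zariski open of `X` if it is the image of
`∐ U i ⟶ X` for some (small, possibly infinite) family of affine Zariski opens `U i ⟶ X`. -/
def IsOpenSubsheaf (X : Kᵒᵖ) (F : Subfunctor (yoneda.obj X)) : Prop :=
  ∃ (ι : Type u) (U : ι → Kᵒᵖ) (p : ∀ i, U i ⟶ X),
    (∀ i, IsAffineOpen M (p i)) ∧ F = sheafImage M (fun i => yoneda.map (p i))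

/-- A morphism `F ⟶ G` is a Zariski open immersion if for every affine scheme `X` and every
`X ⟶ G`, the projection `F ×_G X ⟶ X` is a monomorphism whose image is a Zariski open of `X`. -/
def IsOpenImmersion {F G : Kᵒᵖᵒᵖ ⥤ Type u} (f : F ⟶ G) : Prop :=
  ∀ (X : Kᵒᵖ) (x : yoneda.obj X ⟶ G) (P : Kᵒᵖᵒᵖ ⥤ Type u) (q₁ : P ⟶ F) (q₂ : P ⟶ yoneda.obj X),
    IsPullback q₁ q₂ f x →
      Mono q₂ ∧ IsOpenSubsheaf M X (sheafImage M (fun _ : PUnit.{u + 1} => q₂))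

/-- A Zariski sheaf `F` is a scheme if there is a (small) family of affine schemes `X i` with open
immersions `X i ⟶ F` such that `∐ X i ⟶ F` is an epimorphism of sheaves. -/
def IsScheme : ObjectProperty (ZarSheaf M) := fun F =>
  ∃ (ι : Type u) (X : ι → Kᵒᵖ) (p : ∀ i, yoneda.obj (X i) ⟶ F.obj),
    (∀ i, IsOpenImmersion M (p i)) ∧ sheafImage M p = ⊤

/-- The category of schemes, a full subcategory of the category of Zariski sheaves. -/
abbrev Sch : Type (u + 1) := (IsScheme M).FullSubcategory

end General

/-! ## `ℤ`-schemes and `ℕ`-schemes -/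

/-- Commutative rings (commutative monoids in `ℤ`-modules) and their modules. -/
def intModules : ModuleData.{u} CommRingCat.{u} where
  Mod A := ModuleCat.{u} A
  modCategory _ := inferInstance
  baseChange φ := ModuleCat.extendScalars φ.hom

/-- Extension of scalars `P ↦ B ⊗_A P` for semimodules along a homomorphism `A → B` of commutative
semirings. -/
def semimoduleExtendScalars {A B : Type u} [CommSemiring A] [CommSemiring B] (φ : A →+* B) :
    SemimoduleCat.{u} A ⥤ SemimoduleCat.{u} B :=
  letI := φ.toAlgebra
  { obj P := SemimoduleCat.of B (B ⊗[A] P)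
    map v := SemimoduleCat.ofHom (v.hom.baseChange B)
    map_id P := by
      ext x
      simp
    map_comp v w := by
      ext x
      simp [LinearMap.baseChange_comp] }

/-- Commutative semirings (commutative monoids in `ℕ`-modules) and their semimodules. -/
def natModules : ModuleData.{u} CommSemiRingCat.{u} where
  Mod A := SemimoduleCat.{u} A
  modCategory _ := inferInstance
  baseChange φ := semimoduleExtendScalars φ.hom

/-- The category of `ℤ`-schemes. -/
abbrev IntSch : Type (u + 1) := Sch intModules.{u}

/-- The category of `ℕ`-schemes. -/
abbrev NatSch : Type (u + 1) := Sch natModules.{u}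

/-! ## Base change from `ℕ` to `ℤ` -/

/-- The functor `A ↦ ℤ ⊗_ℕ A` (group completion) from commutative semirings to commutative
rings. -/
def ringCompletion : CommSemiRingCat.{u} ⥤ CommRingCat.{u} where
  obj A := CommRingCat.of (ℤ ⊗[ℕ] A)
  map φ := CommRingCat.ofHom
    (Algebra.TensorProduct.map (AlgHom.id ℤ ℤ) φ.hom.toNatAlgHom).toRingHom
  map_id A := by
    refine CommRingCat.hom_ext (RingHom.ext fun x => ?_)
    induction x using TensorProduct.induction_on with
    | zero => simp
    | tmul a b => simp
    | add a b ha hb => simp_all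
  map_comp φ ψ := by
    refine CommRingCat.hom_ext (RingHom.ext fun x => ?_)
    induction x using TensorProduct.induction_on with
    | zero => simp
    | tmul a b => simp
    | add a b ha hb => simp_all

/-- Base change of affine schemes, `Spec A ↦ Spec (A ⊗_ℕ ℤ)`. -/
def affineBaseChange : CommSemiRingCat.{u}ᵒᵖ ⥤ CommRingCat.{u}ᵒᵖ :=
  ringCompletion.op

/-- Precomposition with the base change of affine schemes sends Zariski sheaves to
Zariski sheaves. -/
abbrev AffineBaseChangeContinuous : Prop :=
  Functor.IsContinuous affineBaseChange.{u}
    (zariskiTopology natModules.{u}) (zariskiTopology intModules.{u})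

/-- Precomposition with the base change of affine schemes, as a functor from Zariski sheaves
over `ℤ` to Zariski sheaves over `ℕ`. -/
abbrev sheafRestriction [AffineBaseChangeContinuous.{u}] :
    ZarSheaf intModules.{u} ⥤ ZarSheaf natModules.{u} :=
  affineBaseChange.{u}.sheafPushforwardContinuous (Type u)
    (zariskiTopology natModules.{u}) (zariskiTopology intModules.{u})

/-- Base change of Zariski sheaves from `ℕ` to `ℤ`: the left adjoint of `sheafRestriction`. -/
abbrev sheafBaseChange [AffineBaseChangeContinuous.{u}] [sheafRestriction.{u}.IsRightAdjoint] :
    ZarSheaf natModules.{u} ⥤ ZarSheaf intModules.{u} :=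
  affineBaseChange.{u}.sheafPullback (Type u)
    (zariskiTopology natModules.{u}) (zariskiTopology intModules.{u})

/-- The base change functor `- ⊗_ℕ ℤ` from `ℕ`-schemes to `ℤ`-schemes: the restriction of
`sheafBaseChange` to schemes. -/
def schemeBaseChange [AffineBaseChangeContinuous.{u}] [sheafRestriction.{u}.IsRightAdjoint]
    (h : ∀ X : NatSch.{u}, IsScheme intModules.{u} (sheafBaseChange.{u}.obj X.obj)) :
    NatSch.{u} ⥤ IntSch.{u} :=
  (IsScheme intModules.{u}).lift ((IsScheme natModules.{u}).ι ⋙ sheafBaseChange.{u}) h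

end RelScheme

end

/-! A commutative semiring is a ring exactly when `1` has an additive inverse, and every
homomorphism preserves this. So the inclusion i of Aff_ℤ in Aff_ℕ is fully faithful, and any object
of Aff_ℕ mapping to the spectrum of a ring is itself the spectrum of a ring. Moreover i is left
adjoint to the affine base change f.

Over a ring the two notions of module, Zariski open and covering agree, and group completion
preserves opens and coverings. Hence i is continuous and cocontinuous, f is continuous, and i^* ⊣
f^* on sheaves: base change is simply restriction to rings (`sheafBaseChangeIso`).

On presheaves i^* has a left adjoint, the left Kan extension, which extends by the empty set outside
rings and is fully faithful because i is. It preserves sheaves because being a ring is Zariski local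
(`isRingLike_of_mem_zariskiTopology`): this property amounts to invertibility of the linear shear
(x, y) ↦ (x, x + y), which jointly conservative base changes detect. Finally, both functors preserve
schemes, since open subsheaves of the spectrum of a ring are the same on both sites
(`isOpenSubsheaf_affineInclusion_iff`). -/

noncomputable section

namespace RelScheme

/-! ### Rings among semirings -/

/-- The inclusion of commutative rings in commutative semirings. -/
abbrev ringToSemiring : CommRingCat.{u} ⥤ CommSemiRingCat.{u} :=
  forget₂ CommRingCat CommSemiRingCat

/-- A commutative semiring is a ring if `1` has an additive inverse. -/
def IsRingLike (A : Type u) [CommSemiring A] : Prop := IsAddUnit (1 : A)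

theorem IsRingLike.map {A B : Type u} [CommSemiring A] [CommSemiring B] (φ : A →+* B)
    (h : IsRingLike A) : IsRingLike B := by
  simpa [IsRingLike] using IsAddUnit.map φ.toAddMonoidHom h

theorem isRingLike_of_ring (A : Type u) [CommRing A] : IsRingLike A :=
  AddGroup.isAddUnit 1

/-- The ring structure on a commutative semiring in which `1` has an additive inverse. -/
abbrev IsRingLike.commRing {A : Type u} [inst : CommSemiring A] (h : IsRingLike A) : CommRing A :=
  letI : Neg A := ⟨fun a => (isAddUnit_iff_exists_neg.1 h).choose * a⟩
  { inst with
    neg a := -a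
    neg_add_cancel a := by
      calc (isAddUnit_iff_exists_neg.1 h).choose * a + a
          = (1 + (isAddUnit_iff_exists_neg.1 h).choose) * a := by
            rw [add_mul, one_mul, add_comm]
        _ = 0 := by rw [(isAddUnit_iff_exists_neg.1 h).choose_spec, zero_mul]
    zsmul := zsmulRec }

/-- The ring structure extends the given semiring structure, so forgetting negation returns `A` on
the nose. Equality instead of isomorphism allows substitution of rings for semirings later on. -/
theorem IsRingLike.exists_eq {A : CommSemiRingCat.{u}} (h : IsRingLike A) :
    ∃ B : CommRingCat.{u}, A = ringToSemiring.obj B :=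
  ⟨@CommRingCat.of A h.commRing, rfl⟩

instance : ringToSemiring.{u}.Full where
  map_surjective f := ⟨CommRingCat.ofHom f.hom, rfl⟩

instance : ringToSemiring.{u}.Faithful where
  map_injective h := CommRingCat.hom_ext (congrArg CommSemiRingCat.Hom.hom h)

theorem exists_eq_of_hom {A : CommRingCat.{u}} {B : CommSemiRingCat.{u}}
    (φ : ringToSemiring.obj A ⟶ B) : ∃ C : CommRingCat.{u}, B = ringToSemiring.obj C :=
  (IsRingLike.map φ.hom (isRingLike_of_ring A)).exists_eq

theorem ringHom_ext_int_tensor {A B : Type u} [CommSemiring A] [CommRing B]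
    {φ ψ : ℤ ⊗[ℕ] A →+* B} (h : ∀ a : A, φ (1 ⊗ₜ a) = ψ (1 ⊗ₜ a)) : φ = ψ := by
  refine RingHom.ext fun x => ?_
  induction x using TensorProduct.induction_on with
  | zero => simp
  | tmul n a =>
    have : (n ⊗ₜ[ℕ] a : ℤ ⊗[ℕ] A) = n • (1 ⊗ₜ[ℕ] a) := by
      rw [TensorProduct.smul_tmul', smul_eq_mul, mul_one]
    rw [this, map_zsmul, map_zsmul, h]
  | add x y hx hy => rw [map_add, map_add, hx, hy]

/-- Group completion of semirings is left adjoint to the inclusion of rings. -/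
def ringCompletionAdjunction : ringCompletion.{u} ⊣ ringToSemiring.{u} :=
  Adjunction.mkOfHomEquiv
    { homEquiv A B :=
        { toFun φ := CommSemiRingCat.ofHom
            (φ.hom.comp (Algebra.TensorProduct.includeRight : A →ₐ[ℕ] ℤ ⊗[ℕ] A).toRingHom)
          invFun φ := CommRingCat.ofHom (Algebra.TensorProduct.lift (Algebra.ofId ℤ B)
            φ.hom.toNatAlgHom (fun _ _ => Commute.all _ _)).toRingHom
          left_inv φ := by
            refine CommRingCat.hom_ext (ringHom_ext_int_tensor fun a => ?_)
            change ((1 : ℤ) : B) * φ.hom _ = φ.hom _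
            rw [Int.cast_one, one_mul]
            rfl
          right_inv φ := by
            refine CommSemiRingCat.hom_ext (RingHom.ext fun x => ?_)
            change ((1 : ℤ) : B) * φ.hom x = φ.hom x
            rw [Int.cast_one, one_mul] }
      homEquiv_naturality_left_symm φ ψ :=
        CommRingCat.hom_ext (ringHom_ext_int_tensor fun a => rfl)
      homEquiv_naturality_right _ _ := rfl }

/-- The explicit filtered colimit of rings has that of the underlying semirings as its underlying
semiring. -/
instance preservesFilteredColimits_ringToSemiring :
    PreservesFilteredColimits ringToSemiring.{u} where
  preserves_filtered_colimits _ _ _ :=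
    { preservesColimit := fun {F} =>
        preservesColimit_of_preserves_colimit_cocone
          (CommRingCat.FilteredColimits.colimitCoconeIsColimit.{u, u} F)
          (CommSemiRingCat.FilteredColimits.colimitCoconeIsColimit.{u, u} (F ⋙ ringToSemiring)) }

/-! ### Epimorphisms and finite presentation -/

/-- Every semiring receiving a map from `B` is a ring, so testing against semirings is no stronger
than testing against rings. -/
theorem epi_ringToSemiring_map {A B : CommRingCat.{u}} (φ : A ⟶ B) :
    Epi (ringToSemiring.map φ) ↔ Epi φ := by
  refine ⟨fun _ => ringToSemiring.epi_of_epi_map inferInstance, fun _ => ⟨fun {C} a b h => ?_⟩⟩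
  obtain ⟨C, rfl⟩ := exists_eq_of_hom a
  obtain ⟨a, rfl⟩ := ringToSemiring.map_surjective a
  obtain ⟨b, rfl⟩ := ringToSemiring.map_surjective b
  rw [← Functor.map_comp, ← Functor.map_comp] at h
  rw [(cancel_epi φ).1 (ringToSemiring.map_injective h)]

instance (A : CommRingCat.{u}) : (Under.post (X := A) ringToSemiring.{u}).EssSurj where
  mem_essImage B := by
    obtain ⟨X, B, φ⟩ := B
    obtain ⟨C, rfl⟩ := exists_eq_of_hom φ
    obtain ⟨φ, rfl⟩ := ringToSemiring.map_surjective φ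
    exact ⟨Under.mk φ, ⟨Under.isoMk (Iso.refl _)⟩⟩

instance (A : CommRingCat.{u}) : (Under.post (X := A) ringToSemiring.{u}).IsEquivalence where

attribute [local instance] Cardinal.fact_isRegular_aleph0

theorem isFinPres_ringToSemiring_map {A B : CommRingCat.{u}} (φ : A ⟶ B) :
    IsFinPres (ringToSemiring.map φ) ↔ IsFinPres φ :=
  isCardinalPresentable_iff_of_isEquivalence (Under.mk φ) _ (Under.post (X := A) ringToSemiring)

/-- A left adjoint preserves finitely presentable objects when its right adjoint preserves filtered
colimits. Here the right adjoint takes an algebra over the completion of `A` to its underlying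
`A`-algebra. -/
theorem isFinPres_ringCompletion_map {A B : CommSemiRingCat.{u}} (φ : A ⟶ B)
    (h : IsFinPres φ) : IsFinPres (ringCompletion.map φ) := by
  let adj := Under.postAdjunctionLeft (X := A) ringCompletionAdjunction
  have : Functor.IsCardinalAccessible.{u} (Under.post ringToSemiring.{u} ⋙
      Under.map (ringCompletionAdjunction.unit.app A)) Cardinal.aleph0 := by
    refine ⟨fun J _ _ => ?_⟩
    have : IsFiltered J := by rwa [← isCardinalFiltered_aleph0_iff]
    -- Forgetting the structure map from the base preserves connected colimits.
    have := IsFiltered.isConnected J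
    refine ⟨fun {D} => ?_⟩
    have : PreservesColimit D ((Under.post ringToSemiring.{u} ⋙
      Under.map (ringCompletionAdjunction.unit.app A)) ⋙ Under.forget _) :=
      inferInstanceAs <| PreservesColimit D (Under.forget _ ⋙ ringToSemiring)
    exact preservesColimit_of_reflects_of_preserves _ (Under.forget _)
  have : IsCardinalPresentable.{u} (Under.mk φ) Cardinal.aleph0 := h
  exact adj.isCardinalPresentable_leftAdjoint_obj Cardinal.aleph0 (Under.mk φ)

/-! ### Modules over semirings and over rings -/

/-- Over rings, the two extension of scalars functors agree. -/
def ringExtendScalarsIso {A B : Type u} [CommRing A] [CommRing B] (φ : A →+* B) :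
    ModuleCat.extendScalars.{u, u, u} φ ⋙ (ModuleCat.equivalenceSemimoduleCat (R := B)).functor ≅
    (ModuleCat.equivalenceSemimoduleCat (R := A)).functor ⋙ semimoduleExtendScalars φ :=
  NatIso.ofComponents (fun _ => Iso.refl _) (fun _ => rfl)

/-- Restriction of scalars of semimodules. -/
def semimoduleRestrictScalars {A B : Type u} [CommSemiring A] [CommSemiring B] (φ : A →+* B) :
    SemimoduleCat.{u} B ⥤ SemimoduleCat.{u} A where
  obj P := letI := Module.compHom P φ; SemimoduleCat.of A P
  map {P Q} v := letI := Module.compHom P φ; letI := Module.compHom Q φ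
    SemimoduleCat.ofHom { v.hom.toAddMonoidHom with map_smul' a x := v.hom.map_smul (φ a) x }

instance {A B : Type u} [CommSemiring A] [CommSemiring B] (φ : A →+* B) :
    (semimoduleRestrictScalars φ).ReflectsIsomorphisms where
  reflects {P Q} v h := by
    have h' : Function.Bijective v.hom :=
      (ConcreteCategory.isIso_iff_bijective ((semimoduleRestrictScalars φ).map v)).1 h
    exact (ConcreteCategory.isIso_iff_bijective v).2 h'

/-- The bijection `Hom_B(B ⊗_A N, Q) ≃ Hom_A(N, Q)`. -/
def semimoduleExtendRestrictHomEquiv {A B : Type u} [CommSemiring A] [CommSemiring B]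
    (φ : A →+* B) (N : SemimoduleCat.{u} A) (Q : SemimoduleCat.{u} B) :
    ((semimoduleExtendScalars φ).obj N ⟶ Q) ≃ (N ⟶ (semimoduleRestrictScalars φ).obj Q) :=
  letI := φ.toAlgebra
  letI : Module A Q := Module.compHom Q φ
  haveI : IsScalarTower A B Q := ⟨fun a b q => by
    rw [Algebra.smul_def, mul_smul]; rfl⟩
  letI e : (N →ₗ[A] Q) ≃ (B ⊗[A] N →ₗ[B] Q) := (LinearMap.liftBaseChangeEquiv B).toEquiv
  (SemimoduleCat.homEquiv.trans e.symm).trans SemimoduleCat.homEquiv.symm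

/-- Extension of scalars of semimodules is left adjoint to restriction of scalars. -/
def semimoduleExtendRestrictAdjunction {A B : Type u} [CommSemiring A] [CommSemiring B]
    (φ : A →+* B) : semimoduleExtendScalars φ ⊣ semimoduleRestrictScalars φ :=
  Adjunction.mkOfHomEquiv
    { homEquiv := semimoduleExtendRestrictHomEquiv φ
      homEquiv_naturality_left_symm {N N' Q} v w := by
        refine SemimoduleCat.hom_ext (LinearMap.ext fun x => ?_)
        induction x using TensorProduct.induction_on with
        | zero => exact (map_zero _).trans (map_zero _).symm
        | add x y hx hy =>
          exact (map_add _ x y).trans ((congrArg₂ _ hx hy).trans (map_add _ x y).symm)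
        | tmul b n => rfl
      homEquiv_naturality_right v w := rfl }

/-- Restriction of scalars from modules over a ring to semimodules over a semiring. -/
def restrictToSemimodule {A B : Type u} [CommSemiring A] [CommRing B] (φ : A →+* B) :
    ModuleCat.{u} B ⥤ SemimoduleCat.{u} A :=
  (ModuleCat.equivalenceSemimoduleCat (R := B)).functor ⋙ semimoduleRestrictScalars φ

instance restrictToSemimodule_preservesFiniteLimits {A B : Type u} [CommSemiring A] [CommRing B]
    (φ : A →+* B) : PreservesFiniteLimits (restrictToSemimodule φ) :=
  have : PreservesLimitsOfSize.{0, 0} (semimoduleRestrictScalars φ) :=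
    (semimoduleExtendRestrictAdjunction φ).rightAdjoint_preservesLimits
  have := PreservesLimitsOfSize.preservesFiniteLimits (semimoduleRestrictScalars φ)
  comp_preservesFiniteLimits (ModuleCat.equivalenceSemimoduleCat (R := B)).functor
    (semimoduleRestrictScalars φ)

instance restrictToSemimodule_reflectsIsomorphisms {A B : Type u} [CommSemiring A] [CommRing B]
    (φ : A →+* B) : (restrictToSemimodule φ).ReflectsIsomorphisms :=
  inferInstanceAs ((ModuleCat.equivalenceSemimoduleCat (R := B)).functor ⋙
    semimoduleRestrictScalars φ).ReflectsIsomorphisms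

/-! ### Base change of modules and group completion of algebras -/

section

variable {A B P : Type u} [CommSemiring A] [CommSemiring B] [Algebra A B]
  [Algebra (ℤ ⊗[ℕ] A) (ℤ ⊗[ℕ] B)] [AddCommGroup P] [Module (ℤ ⊗[ℕ] A) P] [Module A P]

theorem int_tmul_eq (n : ℤ) (a : A) :
    (n ⊗ₜ[ℕ] a : ℤ ⊗[ℕ] A) = (n : ℤ ⊗[ℕ] A) * (1 ⊗ₜ[ℕ] a) := by
  rw [← zsmul_eq_mul]
  exact (congrArg (· ⊗ₜ[ℕ] a) (mul_one n)).symm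

/-- The comparison map `B ⊗_A P → B_ℤ ⊗_{A_ℤ} P`. -/
def completionCompare
    (hB : ∀ a : A, algebraMap (ℤ ⊗[ℕ] A) (ℤ ⊗[ℕ] B) (1 ⊗ₜ a) = 1 ⊗ₜ algebraMap A B a)
    (hP : ∀ (a : A) (p : P), ((1 : ℤ) ⊗ₜ[ℕ] a : ℤ ⊗[ℕ] A) • p = a • p) :
    B ⊗[A] P →+ (ℤ ⊗[ℕ] B) ⊗[ℤ ⊗[ℕ] A] P :=
  TensorProduct.liftAddHom
    { toFun b := ((TensorProduct.mk (ℤ ⊗[ℕ] A) (ℤ ⊗[ℕ] B) P) (1 ⊗ₜ b)).toAddMonoidHom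
      map_zero' := by ext; simp
      map_add' b c := by ext; simp [TensorProduct.tmul_add] }
    (fun a b p => by
      change ((1 : ℤ) ⊗ₜ[ℕ] (a • b)) ⊗ₜ[ℤ ⊗[ℕ] A] p = (1 ⊗ₜ[ℕ] b) ⊗ₜ[ℤ ⊗[ℕ] A] (a • p)
      rw [← hP, ← TensorProduct.smul_tmul (1 ⊗ₜ[ℕ] a : ℤ ⊗[ℕ] A), Algebra.smul_def, Algebra.smul_def, hB,
        Algebra.TensorProduct.tmul_mul_tmul, one_mul])

/-- The inverse of the comparison map `B ⊗_A P → B_ℤ ⊗_{A_ℤ} P`. -/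
def completionCompareInv
    (hB : ∀ a : A, algebraMap (ℤ ⊗[ℕ] A) (ℤ ⊗[ℕ] B) (1 ⊗ₜ a) = 1 ⊗ₜ algebraMap A B a)
    (hP : ∀ (a : A) (p : P), ((1 : ℤ) ⊗ₜ[ℕ] a : ℤ ⊗[ℕ] A) • p = a • p) :
    (ℤ ⊗[ℕ] B) ⊗[ℤ ⊗[ℕ] A] P →+ B ⊗[A] P :=
  TensorProduct.liftAddHom
    -- On generators (n ⊗ b) ⊗ p ↦ b ⊗ n p: the integer moves to the group `P`, since `B` may lack
    -- negatives.
    (TensorProduct.lift (LinearMap.mk₂ ℕ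
      (fun (n : ℤ) (b : B) => ((TensorProduct.mk A B P b).toAddMonoidHom.comp
        (DistribSMul.toAddMonoidHom P n)))
      (fun m n b => by ext; simp [add_smul, TensorProduct.tmul_add])
      (fun k n b => by ext; simp [mul_smul])
      (fun n b c => by ext; simp)
      (fun k n b => by ext; simp [TensorProduct.smul_tmul']))).toAddMonoidHom
    (fun x y p => by
      induction x using TensorProduct.induction_on with
      | zero =>
        -- Stating this for an arbitrary `F` avoids unfolding the lifted map.
        have (F : ℤ ⊗[ℕ] B →+ P →+ B ⊗[A] P) :
            F ((0 : ℤ ⊗[ℕ] A) • y) p = F y ((0 : ℤ ⊗[ℕ] A) • p) := by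
          have hy : (0 : ℤ ⊗[ℕ] A) • y = 0 := by
            rw [Algebra.smul_def, map_zero, zero_mul]
          have hp : (0 : ℤ ⊗[ℕ] A) • p = 0 := Module.zero_smul p
          rw [hy, hp, map_zero, map_zero, AddMonoidHom.zero_apply]
        exact this _
      | add x x' hx hx' => simp only [add_smul, map_add, AddMonoidHom.add_apply, hx, hx']
      | tmul n a =>
        induction y using TensorProduct.induction_on with
        | zero => rw [smul_zero, map_zero, AddMonoidHom.zero_apply, AddMonoidHom.zero_apply]
        | add y y' hy hy' => simp only [smul_add, map_add, AddMonoidHom.add_apply, hy, hy']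
        | tmul m b =>
          have h1 : (n ⊗ₜ[ℕ] a : ℤ ⊗[ℕ] A) • (m ⊗ₜ[ℕ] b : ℤ ⊗[ℕ] B) =
              (n * m) ⊗ₜ (algebraMap A B a * b) := by
            rw [Algebra.smul_def, int_tmul_eq, map_mul, map_intCast, hB, int_tmul_eq m b,
              int_tmul_eq (n * m), Int.cast_mul, mul_mul_mul_comm,
              Algebra.TensorProduct.tmul_mul_tmul, one_mul]
          have h2 : (n ⊗ₜ[ℕ] a : ℤ ⊗[ℕ] A) • p = n • a • p := by
            rw [int_tmul_eq, mul_smul, hP, Int.cast_smul_eq_zsmul]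
          rw [h1, h2, ← Algebra.smul_def]
          change (a • b) ⊗ₜ[A] ((n * m) • p) = b ⊗ₜ[A] (m • n • a • p)
          rw [TensorProduct.smul_tmul, smul_smul, mul_comm n m]
          congr 1
          exact (DistribSMul.toAddMonoidHom P a).map_zsmul _ _)

/-- Since `P` is already a group, so is B ⊗_A P, and adjoining negatives to `A` and `B` changes
nothing. -/
theorem completionCompare_bijective
    (hB : ∀ a : A, algebraMap (ℤ ⊗[ℕ] A) (ℤ ⊗[ℕ] B) (1 ⊗ₜ a) = 1 ⊗ₜ algebraMap A B a)
    (hP : ∀ (a : A) (p : P), ((1 : ℤ) ⊗ₜ[ℕ] a : ℤ ⊗[ℕ] A) • p = a • p) :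
    Function.Bijective (completionCompare (B := B) hB hP) := by
  refine Function.bijective_iff_has_inverse.2 ⟨completionCompareInv hB hP, fun x => ?_, fun x => ?_⟩
  · induction x using TensorProduct.induction_on with
    | zero => simp
    | add x y hx hy => simp only [map_add, hx, hy]
    | tmul b p =>
      change b ⊗ₜ[A] ((1 : ℤ) • p) = _
      rw [one_smul]
  · induction x using TensorProduct.induction_on with
    | zero => simp
    | add x y hx hy => simp only [map_add, hx, hy]
    | tmul y p =>
      induction y using TensorProduct.induction_on with
      | zero => simp
      | add y z hy hz => simp only [TensorProduct.add_tmul, map_add, hy, hz]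
      | tmul n b =>
        change ((1 : ℤ) ⊗ₜ[ℕ] b) ⊗ₜ[ℤ ⊗[ℕ] A] (n • p) = _
        rw [← Int.cast_smul_eq_zsmul (ℤ ⊗[ℕ] A) n p, ← TensorProduct.smul_tmul, int_tmul_eq n b,
          Algebra.smul_def, map_intCast]

end

/-- The structure map from a semiring to its group completion. -/
def toCompletion (A : CommSemiRingCat.{u}) : A →+* ringCompletion.obj A :=
  (Algebra.TensorProduct.includeRight : A →ₐ[ℕ] ℤ ⊗[ℕ] A).toRingHom

/-- The components of `completionExtendScalarsIso`. -/
def completionExtendScalarsIsoApp {A B : CommSemiRingCat.{u}} (φ : A ⟶ B)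
    (P : ModuleCat.{u} (ringCompletion.obj A)) :
    (restrictToSemimodule (toCompletion A) ⋙ semimoduleExtendScalars φ.hom).obj P ≅
      (ModuleCat.extendScalars (ringCompletion.map φ).hom ⋙
        restrictToSemimodule (toCompletion B)).obj P :=
  letI := φ.hom.toAlgebra
  letI : Algebra (ℤ ⊗[ℕ] A) (ℤ ⊗[ℕ] B) := (ringCompletion.map φ).hom.toAlgebra
  letI : Module (ℤ ⊗[ℕ] A) P := P.isModule
  letI : Module A P := Module.compHom P (toCompletion A)
  letI : Module B ((ℤ ⊗[ℕ] B) ⊗[ℤ ⊗[ℕ] A] P) := Module.compHom _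
    (Algebra.TensorProduct.includeRight : B →ₐ[ℕ] ℤ ⊗[ℕ] B).toRingHom
  haveI hB (a : A) : algebraMap (ℤ ⊗[ℕ] A) (ℤ ⊗[ℕ] B) (1 ⊗ₜ a) = 1 ⊗ₜ algebraMap A B a := rfl
  haveI hP (a : A) (p : P) : ((1 : ℤ) ⊗ₜ[ℕ] a : ℤ ⊗[ℕ] A) • p = a • p := rfl
  letI e := AddEquiv.ofBijective _ (completionCompare_bijective (B := B) (P := P) hB hP)
  letI l : B ⊗[A] P ≃ₗ[B] (ℤ ⊗[ℕ] B) ⊗[ℤ ⊗[ℕ] A] P :=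
    { e with
      map_smul' b x := by
        change e (b • x) = ((1 : ℤ) ⊗ₜ[ℕ] b) • e x
        induction x using TensorProduct.induction_on with
        | zero => rw [smul_zero, map_zero, smul_zero]
        | add x y hx hy => rw [smul_add, map_add, hx, hy, map_add, smul_add]
        | tmul c p =>
          change ((1 : ℤ) ⊗ₜ[ℕ] (b * c)) ⊗ₜ[ℤ ⊗[ℕ] A] p =
            (((1 : ℤ) ⊗ₜ[ℕ] b) * ((1 : ℤ) ⊗ₜ[ℕ] c)) ⊗ₜ[ℤ ⊗[ℕ] A] p
          rw [Algebra.TensorProduct.tmul_mul_tmul, one_mul] }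
  l.toModuleIsoₛ

/-- Extension of scalars along a map of semirings, restricted to modules over the group
completion, is extension of scalars along the map of group completions. -/
def completionExtendScalarsIso {A B : CommSemiRingCat.{u}} (φ : A ⟶ B) :
    restrictToSemimodule (toCompletion A) ⋙ semimoduleExtendScalars φ.hom ≅
      ModuleCat.extendScalars (ringCompletion.map φ).hom ⋙ restrictToSemimodule (toCompletion B) :=
  NatIso.ofComponents (completionExtendScalarsIsoApp φ) (fun {P Q} v => by
    refine SemimoduleCat.hom_ext (LinearMap.ext fun x => ?_)
    induction x using TensorProduct.induction_on with
    | zero => exact (map_zero _).trans (map_zero _).symm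
    | add x y hx hy =>
      exact (map_add _ x y).trans ((congrArg₂ _ hx hy).trans (map_add _ x y).symm)
    | tmul b n => rfl)

/-! ### Flatness, Zariski opens and coverings -/

theorem preservesFiniteLimits_of_comp {C D E : Type*} [Category* C] [Category* D] [Category* E]
    (F : C ⥤ D) (G : D ⥤ E) [PreservesFiniteLimits (F ⋙ G)] [PreservesFiniteLimits G]
    [G.ReflectsIsomorphisms] [HasFiniteLimits D] : PreservesFiniteLimits F where
  preservesFiniteLimits J _ _ :=
    have : ReflectsLimitsOfShape J G := reflectsLimitsOfShape_of_reflectsIsomorphisms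
    preservesLimitsOfShape_of_reflects_of_preserves F G

/-- A semimodule over a ring is a module, as −1 acts by negation; the resulting equivalences
intertwine the two base changes. -/
theorem isFlat_ringToSemiring_map {A B : CommRingCat.{u}} (φ : A ⟶ B) :
    IsFlat natModules (ringToSemiring.map φ) ↔ IsFlat intModules φ := by
  let EA := ModuleCat.equivalenceSemimoduleCat.{u} (R := A)
  let EB := ModuleCat.equivalenceSemimoduleCat.{u} (R := B)
  let i := ringExtendScalarsIso φ.hom
  change PreservesFiniteLimits (semimoduleExtendScalars φ.hom) ↔
    PreservesFiniteLimits (ModuleCat.extendScalars φ.hom)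
  constructor
  · intro h
    have : PreservesFiniteLimits (ModuleCat.extendScalars φ.hom ⋙ EB.functor) :=
      preservesFiniteLimits_of_natIso i.symm
    exact preservesFiniteLimits_of_comp _ EB.functor
  · intro h
    have : PreservesFiniteLimits (EA.inverse ⋙ EA.functor ⋙ semimoduleExtendScalars φ.hom) := by
      have : PreservesFiniteLimits (EA.functor ⋙ semimoduleExtendScalars φ.hom) :=
        preservesFiniteLimits_of_natIso i
      infer_instance
    exact preservesFiniteLimits_of_natIso
      (EA.invFunIdAssoc (semimoduleExtendScalars φ.hom))

/-- Base change along the completed map, followed by restriction to `B`, is restriction to `A`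
followed by base change along `φ`, hence left exact. Restriction is conservative and left exact, so
it can be cancelled. -/
theorem isFlat_ringCompletion_map {A B : CommSemiRingCat.{u}} (φ : A ⟶ B)
    (h : IsFlat natModules φ) : IsFlat intModules (ringCompletion.map φ) := by
  have h : PreservesFiniteLimits (semimoduleExtendScalars φ.hom) := h
  have : PreservesFiniteLimits (ModuleCat.extendScalars (ringCompletion.map φ).hom ⋙
      restrictToSemimodule (toCompletion B)) :=
    preservesFiniteLimits_of_natIso (completionExtendScalarsIso φ)
  exact preservesFiniteLimits_of_comp (ModuleCat.extendScalars (ringCompletion.map φ).hom)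
    (restrictToSemimodule (toCompletion B))

/-- A family of algebra morphisms out of `A` is jointly conservative if the base change functors
are. -/
def JointlyConservative {K : Type (u + 1)} [Category.{u} K] (M : ModuleData.{u} K) {A : K}
    {n : ℕ} {B : Fin n → K} (φ : ∀ j, A ⟶ B j) : Prop :=
  ∀ ⦃P Q : M.Mod A⦄ (v : P ⟶ Q), (∀ j, IsIso ((M.baseChange (φ j)).map v)) → IsIso v

theorem jointlyConservative_ringToSemiring_map {A : CommRingCat.{u}} {n : ℕ}
    {B : Fin n → CommRingCat.{u}} (φ : ∀ j, A ⟶ B j) :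
    JointlyConservative natModules (fun j => ringToSemiring.map (φ j)) ↔
      JointlyConservative intModules φ := by
  let EA := ModuleCat.equivalenceSemimoduleCat.{u} (R := A)
  have key {P Q : ModuleCat.{u} A} (v : P ⟶ Q) (j : Fin n) :
      IsIso ((semimoduleExtendScalars (φ j).hom).map (EA.functor.map v)) ↔
        IsIso ((ModuleCat.extendScalars (φ j).hom).map v) := by
    rw [← isIso_iff_of_reflects_iso _ (ModuleCat.equivalenceSemimoduleCat.{u} (R := B j)).functor]
    exact (NatIso.isIso_map_iff (ringExtendScalarsIso (φ j).hom) v).symm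
  constructor
  · intro h (P : ModuleCat A) (Q : ModuleCat A) (v : P ⟶ Q) hv
    refine (isIso_iff_of_reflects_iso v EA.functor).1 ?_
    exact h (EA.functor.map v) fun j => (key v j).2 (hv j)
  · intro h (P : SemimoduleCat A) (Q : SemimoduleCat A) (v : P ⟶ Q) hv
    refine (isIso_iff_of_reflects_iso v EA.inverse).1 ?_
    refine h (EA.inverse.map v) fun j => (key (EA.inverse.map v) j).1 ?_
    exact (NatIso.isIso_map_iff (EA.invFunIdAssoc (semimoduleExtendScalars (φ j).hom)) v).2 (hv j)

theorem jointlyConservative_ringCompletion_map {A : CommSemiRingCat.{u}} {n : ℕ}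
    {B : Fin n → CommSemiRingCat.{u}} (φ : ∀ j, A ⟶ B j) (h : JointlyConservative natModules φ) :
    JointlyConservative intModules (fun j => ringCompletion.map (φ j)) := by
  intro (P : ModuleCat (ringCompletion.obj A)) (Q : ModuleCat (ringCompletion.obj A)) (v : P ⟶ Q) hv
  refine (isIso_iff_of_reflects_iso v (restrictToSemimodule (toCompletion A))).1 ?_
  refine h _ fun j => ?_
  refine (NatIso.isIso_map_iff (completionExtendScalarsIso (φ j)) v).2 ?_
  have : IsIso ((ModuleCat.extendScalars (ringCompletion.map (φ j)).hom).map v) := hv j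
  exact (inferInstance : IsIso ((restrictToSemimodule (toCompletion (B j))).map
    ((ModuleCat.extendScalars (ringCompletion.map (φ j)).hom).map v)))

/-- The inclusion of affine `ℤ`-schemes in affine `ℕ`-schemes. -/
abbrev affineInclusion : CommRingCat.{u}ᵒᵖ ⥤ CommSemiRingCat.{u}ᵒᵖ :=
  ringToSemiring.op

/-- The inclusion of affine `ℤ`-schemes is left adjoint to base change. -/
def affineAdjunction : affineInclusion.{u} ⊣ affineBaseChange.{u} :=
  ringCompletionAdjunction.op

theorem exists_eq_affineInclusion {X : CommSemiRingCat.{u}ᵒᵖ} (h : IsRingLike X.unop) :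
    ∃ Y : CommRingCat.{u}ᵒᵖ, X = affineInclusion.obj Y := by
  obtain ⟨B, hB⟩ := h.exists_eq
  exact ⟨op B, Opposite.unop_injective hB⟩

theorem exists_eq_of_hom_affineInclusion {X : CommSemiRingCat.{u}ᵒᵖ} {Y : CommRingCat.{u}ᵒᵖ}
    (h : X ⟶ affineInclusion.obj Y) : ∃ Z : CommRingCat.{u}ᵒᵖ, X = affineInclusion.obj Z :=
  exists_eq_affineInclusion (IsRingLike.map h.unop.hom (isRingLike_of_ring Y.unop))

theorem isAffineOpen_affineInclusion_map {Y X : CommRingCat.{u}ᵒᵖ} (p : Y ⟶ X) :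
    IsAffineOpen natModules (affineInclusion.map p) ↔ IsAffineOpen intModules p :=
  and_congr (epi_ringToSemiring_map p.unop) <|
    and_congr (isFlat_ringToSemiring_map p.unop) (isFinPres_ringToSemiring_map p.unop)

theorem isAffineOpen_affineBaseChange_map {Y X : CommSemiRingCat.{u}ᵒᵖ} {p : Y ⟶ X}
    (h : IsAffineOpen natModules p) : IsAffineOpen intModules (affineBaseChange.map p) := by
  obtain ⟨h₁, h₂, h₃⟩ := h
  have := ringCompletionAdjunction.{u}.isLeftAdjoint
  exact ⟨(inferInstance : Epi (ringCompletion.map p.unop)), isFlat_ringCompletion_map _ h₂,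
    isFinPres_ringCompletion_map _ h₃⟩

theorem map_mem_zariskiPrecoverage_affineInclusion {X : CommRingCat.{u}ᵒᵖ} {R : Presieve X}
    (hR : R ∈ zariskiPrecoverage intModules X) :
    R.map affineInclusion ∈ zariskiPrecoverage natModules (affineInclusion.obj X) := by
  obtain ⟨h₁, n, Y, p, hp, h₂⟩ := hR
  refine ⟨?_, n, fun j => affineInclusion.obj (Y j), fun j => affineInclusion.map (p j),
    fun j => Presieve.map_map (hp j),
    (jointlyConservative_ringToSemiring_map fun j => (p j).unop).2 h₂⟩
  rintro _ _ ⟨hq⟩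
  exact (isAffineOpen_affineInclusion_map _).2 (h₁ _ hq)

theorem map_mem_zariskiPrecoverage_affineBaseChange {X : CommSemiRingCat.{u}ᵒᵖ} {R : Presieve X}
    (hR : R ∈ zariskiPrecoverage natModules X) :
    R.map affineBaseChange ∈ zariskiPrecoverage intModules (affineBaseChange.obj X) := by
  obtain ⟨h₁, n, Y, p, hp, h₂⟩ := hR
  refine ⟨?_, n, fun j => affineBaseChange.obj (Y j), fun j => affineBaseChange.map (p j),
    fun j => Presieve.map_map (hp j),
    jointlyConservative_ringCompletion_map (fun j => (p j).unop) h₂⟩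
  rintro _ _ ⟨hq⟩
  exact isAffineOpen_affineBaseChange_map (h₁ _ hq)

/-! ### Being a ring is local -/

/-- A preimage of (1, 0) has the form (1, b) with 1 + b = 0. -/
theorem isRingLike_of_shear_bijective {C : Type u} [CommSemiring C]
    (h : Function.Surjective (fun x : C × C => (x.1, x.1 + x.2))) : IsRingLike C := by
  obtain ⟨⟨a, b⟩, hab⟩ := h (1, 0)
  obtain ⟨rfl, h⟩ := Prod.mk.inj hab
  exact isAddUnit_iff_exists_neg.2 ⟨b, h⟩

/-- The shear map `(x, y) ↦ (x, x + y)`. -/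
def shear (A N : Type u) [CommSemiring A] [AddCommMonoid N] [Module A N] :
    N × N →ₗ[A] N × N :=
  (LinearMap.fst A N N).prod (LinearMap.fst A N N + LinearMap.snd A N N)

/-- Tensoring commutes with binary products, so the base-changed shear is conjugate to the shear of
B ⊗_A C. With c = −1, the latter has inverse (x, y) ↦ (x, c x + y). -/
theorem baseChange_shear_bijective {A B C : Type u} [CommSemiring A] [CommSemiring B]
    [CommSemiring C] [Algebra A B] [Algebra A C] (h : IsRingLike (B ⊗[A] C)) :
    Function.Bijective ((shear A C).baseChange B) := by
  obtain ⟨c, hc⟩ := isAddUnit_iff_exists_neg.1 h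
  have hneg (x : B ⊗[A] C) : x + c * x = 0 := by
    rw [← one_add_mul, hc, zero_mul]
  let e := TensorProduct.prodRight A B B C C
  have key (x : B ⊗[A] (C × C)) : e ((shear A C).baseChange B x) =
      ((e x).1, (e x).1 + (e x).2) := by
    induction x using TensorProduct.induction_on with
    | zero => rw [map_zero, map_zero, Prod.fst_zero, Prod.snd_zero, add_zero]; rfl
    | add x y hx hy =>
      rw [map_add, map_add, hx, hy, map_add]
      ext <;> simp [add_add_add_comm]
    | tmul b c => simp [e, shear, TensorProduct.tmul_add]
  rw [← Function.Bijective.of_comp_iff' e.bijective]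
  have : (e ∘ (shear A C).baseChange B) = (fun x => (x.1, x.1 + x.2)) ∘ e := funext key
  rw [this]
  refine Function.Bijective.comp ⟨?_, fun x => ⟨(x.1, c * x.1 + x.2), ?_⟩⟩ e.bijective
  · rintro ⟨x, y⟩ ⟨x', y'⟩ h
    obtain ⟨rfl, h⟩ := Prod.mk.inj h
    have h := congrArg (c * x + ·) h
    simp only [← add_assoc, add_comm (c * x) x, hneg, zero_add] at h
    rw [h]
  · simp only [← add_assoc, hneg, zero_add]

/-- Being a ring can be checked after base change along a jointly conservative family. -/
theorem isRingLike_of_jointlyConservative {A C : CommSemiRingCat.{u}} (ψ : A ⟶ C) {n : ℕ}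
    {B : Fin n → CommSemiRingCat.{u}} (φ : ∀ j, A ⟶ B j) (h : JointlyConservative natModules φ)
    (hB : ∀ j (D : CommSemiRingCat.{u}) (k : C ⟶ D) (l : B j ⟶ D), φ j ≫ l = ψ ≫ k →
      IsRingLike D) : IsRingLike C := by
  let := ψ.hom.toAlgebra
  have hv : IsIso (SemimoduleCat.ofHom (shear A C)) := by
    refine h (SemimoduleCat.ofHom (shear A C)) fun j => ?_
    let := (φ j).hom.toAlgebra
    -- Only the pushout square is needed. The hypothesis ranges over all commutative squares because
    -- these give the members of a pulled-back sieve.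
    have hD : IsRingLike (B j ⊗[A] C) := hB j (CommSemiRingCat.of (B j ⊗[A] C))
      (CommSemiRingCat.ofHom
        (Algebra.TensorProduct.includeRight : C →ₐ[A] B j ⊗[A] C).toRingHom)
      (CommSemiRingCat.ofHom
        (Algebra.TensorProduct.includeLeft : B j →ₐ[A] B j ⊗[A] C).toRingHom)
      (CommSemiRingCat.hom_ext (RingHom.ext fun a =>
        (Algebra.TensorProduct.includeLeft : B j →ₐ[A] B j ⊗[A] C).commutes a |>.trans
        ((Algebra.TensorProduct.includeRight : C →ₐ[A] B j ⊗[A] C).commutes a).symm))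
    exact (ConcreteCategory.isIso_iff_bijective (SemimoduleCat.ofHom
      ((shear A C).baseChange (B j)))).2 (baseChange_shear_bijective hD)
  exact isRingLike_of_shear_bijective ((ConcreteCategory.isIso_iff_bijective
    (SemimoduleCat.ofHom (shear A C))).1 hv).2

/-! ### Comparison of the Zariski topologies -/

/-- A map from the spectrum of a ring to `X` factors through the base change of `X`, so it suffices
to pull back the base-changed covering. -/
instance affineInclusion_isCocontinuous : affineInclusion.{u}.IsCocontinuous
    (zariskiTopology intModules) (zariskiTopology natModules) where
  cover_lift {Y S} hS := by
    -- The induction passes through objects that are not rings, so the claim concerns all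
    -- ring-valued points of the covered object.
    suffices ∀ (Z : CommRingCat.{u}ᵒᵖ) (h : affineInclusion.obj Z ⟶ affineInclusion.obj Y),
        (S.pullback h).functorPullback affineInclusion ∈ zariskiTopology intModules Z by
      simpa using this Y (𝟙 _)
    generalize affineInclusion.obj Y = X at S hS
    induction hS with
    | of X R hR =>
      intro Z h
      refine GrothendieckTopology.superset_covering _ ?_
        (GrothendieckTopology.pullback_stable _ (affineAdjunction.homEquiv _ _ h)
          (Precoverage.generate_mem_toGrothendieck
            (map_mem_zariskiPrecoverage_affineBaseChange hR)))
      rintro W k ⟨_, m, _, ⟨hp⟩, hm⟩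
      refine ⟨_, (affineAdjunction.homEquiv _ _).symm m, _, hp, ?_⟩
      rw [← Adjunction.homEquiv_naturality_right_symm, hm,
        Adjunction.homEquiv_naturality_left_symm, Equiv.symm_apply_apply]
    | top X =>
      intro Z h
      rw [Sieve.pullback_top]
      exact GrothendieckTopology.top_mem _ Z
    | pullback X S _ X' f ih =>
      intro Z h
      rw [← Sieve.pullback_comp]
      exact ih Z (h ≫ f)
    | transitive X S R _ _ ih₁ ih₂ =>
      intro Z h
      refine GrothendieckTopology.transitive _ (ih₁ Z h) _ fun W k hk => ?_
      have := ih₂ hk W (𝟙 _)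
      rw [Sieve.pullback_id, Sieve.pullback_comp] at this
      exact this

theorem affineInclusion_coverPreserving : CoverPreserving
    (zariskiTopology intModules.{u}) (zariskiTopology natModules.{u}) affineInclusion.{u} where
  cover_preserve {Y S} hS := by
    induction hS with
    | of Y R hR =>
      refine GrothendieckTopology.superset_covering _ ?_
        (Precoverage.generate_mem_toGrothendieck (map_mem_zariskiPrecoverage_affineInclusion hR))
      rw [Sieve.generate_le_iff]
      rintro _ _ ⟨hp⟩
      exact Sieve.image_mem_functorPushforward _ _ (Sieve.le_generate _ _ _ hp)
    | top Y =>
      rw [Sieve.functorPushforward_top]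
      exact GrothendieckTopology.top_mem _ _
    | pullback Y S _ Y' f ih =>
      refine GrothendieckTopology.superset_covering _ ?_
        (GrothendieckTopology.pullback_stable _ (affineInclusion.map f) ih)
      intro Z k hk
      -- Everything over the spectrum of a ring comes from rings, so pushing a sieve forward
      -- commutes with pulling it back.
      obtain ⟨Z, rfl⟩ := exists_eq_of_hom_affineInclusion k
      obtain ⟨k, rfl⟩ := affineInclusion.map_surjective k
      refine Sieve.image_mem_functorPushforward _ _ ?_
      rw [Sieve.pullback_apply, ← Functor.map_comp] at hk
      rw [Sieve.pullback_apply]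
      have : (S.functorPushforward affineInclusion).functorPullback affineInclusion (k ≫ f) := hk
      rwa [Sieve.functorPullback_functorPushforward_eq] at this
    | transitive Y S R _ _ ih₁ ih₂ =>
      refine GrothendieckTopology.transitive _ ih₁ _ ?_
      rintro Z _ ⟨W, s, m, hs, rfl⟩
      rw [Sieve.pullback_comp]
      refine GrothendieckTopology.pullback_stable _ m
        (GrothendieckTopology.superset_covering _ ?_ (ih₂ hs))
      rintro V _ ⟨U, t, l, ht, rfl⟩
      refine ⟨U, t ≫ s, l, ht, by simp⟩

theorem affineInclusion_compatiblePreserving : CompatiblePreserving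
    (zariskiTopology natModules.{u}) affineInclusion.{u} :=
  compatiblePreservingOfDownwardsClosed _ _ fun h =>
    ⟨(exists_eq_of_hom_affineInclusion h).choose,
      eqToIso (exists_eq_of_hom_affineInclusion h).choose_spec.symm⟩

instance affineInclusion_isContinuous : affineInclusion.{u}.IsContinuous
    (zariskiTopology intModules) (zariskiTopology natModules) :=
  Functor.isContinuous_of_coverPreserving affineInclusion_compatiblePreserving
    affineInclusion_coverPreserving

instance affineBaseChange_isContinuous : AffineBaseChangeContinuous.{u} :=
  affineAdjunction.isContinuous_of_isCocontinuous _ _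

theorem functorPullback_affineInclusion_mem_iff {Y : CommRingCat.{u}ᵒᵖ}
    {S : Sieve (affineInclusion.obj Y)} :
    S.functorPullback affineInclusion ∈ zariskiTopology intModules Y ↔
      S ∈ zariskiTopology natModules (affineInclusion.obj Y) := by
  refine ⟨fun h => ?_, fun h => affineInclusion.cover_lift _ _ h⟩
  exact GrothendieckTopology.superset_covering _ (Sieve.functorPullback_pushforward_le _ _)
    (affineInclusion_coverPreserving.cover_preserve h)

/-- Being a ring is local for the Zariski topology on semirings. -/
theorem isRingLike_of_mem_zariskiTopology {X : CommSemiRingCat.{u}ᵒᵖ} {S : Sieve X}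
    (hS : S ∈ zariskiTopology natModules X)
    (h : ∀ ⦃Y : CommSemiRingCat.{u}ᵒᵖ⦄ (p : Y ⟶ X), S p → IsRingLike Y.unop) :
    IsRingLike X.unop := by
  -- Locality is proved for all pullbacks of `S`, as stability and transitivity require in the
  -- induction.
  suffices ∀ ⦃Z : CommSemiRingCat.{u}ᵒᵖ⦄ (f : Z ⟶ X),
      (∀ ⦃Y : CommSemiRingCat.{u}ᵒᵖ⦄ (p : Y ⟶ Z), S (p ≫ f) → IsRingLike Y.unop) →
        IsRingLike Z.unop from this (𝟙 X) fun Y p hp => h p (by simpa using hp)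
  clear h
  induction hS with
  | of X R hR =>
    intro Z f h
    obtain ⟨-, n, Y, p, hp, hc⟩ := hR
    refine isRingLike_of_jointlyConservative f.unop (fun j => (p j).unop) hc
      fun j D k l hkl => h (Y := op D) k.op ⟨_, l.op, _, hp j, ?_⟩
    exact Quiver.Hom.unop_inj hkl
  | top X => exact fun Z f h => h (𝟙 Z) trivial
  | pullback X S _ X' g ih =>
    intro Z f h
    exact ih (f ≫ g) fun Y p hp => h p (by simpa using hp)
  | transitive X S R _ _ ih₁ ih₂ =>
    intro Z f h
    refine ih₁ f fun Y p hp => ih₂ hp (𝟙 Y) fun W q hq => h (q ≫ p) ?_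
    simpa using hq

/-! ### Sheaves -/

/-- A presheaf on affine `ℕ`-schemes is supported on rings if it has no sections over semirings
that are not rings. -/
def SupportedOnRings (G : CommSemiRingCat.{u}ᵒᵖᵒᵖ ⥤ Type u) : Prop :=
  ∀ ⦃X : CommSemiRingCat.{u}ᵒᵖ⦄, G.obj (op X) → IsRingLike X.unop

/-- A family of sections on a covering sieve forces its members to be rings, hence the covered
object too by locality. Gluing then takes place among rings. -/
theorem SupportedOnRings.isSheaf {G : CommSemiRingCat.{u}ᵒᵖᵒᵖ ⥤ Type u} (hG : SupportedOnRings G)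
    (h : Presieve.IsSheaf (zariskiTopology intModules) (affineInclusion.op ⋙ G)) :
    Presieve.IsSheaf (zariskiTopology natModules) G := by
  intro X S hS x hx
  obtain ⟨Y, rfl⟩ := exists_eq_affineInclusion
    (isRingLike_of_mem_zariskiTopology hS fun Y p hp => hG (x p hp))
  obtain ⟨t, ht, ht'⟩ := h _ (functorPullback_affineInclusion_mem_iff.2 hS)
    (x.functorPullback affineInclusion) hx.functorPullback
  refine ⟨t, fun Z k hk => ?_, fun s hs => ht' s fun Z k hk => hs _ hk⟩
  obtain ⟨Z, rfl⟩ := exists_eq_of_hom_affineInclusion k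
  obtain ⟨k, rfl⟩ := affineInclusion.map_surjective k
  exact ht k hk

/-- The indexing category is large, so existence of the colimit is not automatic. It has a terminal
object over a ring and is empty otherwise. -/
instance hasPointwiseLeftKanExtension_affineInclusion (F : CommRingCat.{u}ᵒᵖᵒᵖ ⥤ Type u) :
    affineInclusion.op.HasPointwiseLeftKanExtension F := by
  intro X
  by_cases hX : IsRingLike X.unop.unop
  · obtain ⟨Y, hY⟩ := exists_eq_affineInclusion hX
    obtain rfl : X = affineInclusion.op.obj (op Y) := Opposite.unop_injective hY
    have := (CostructuredArrow.mkIdTerminal (S := affineInclusion.{u}.op) (Y := op Y)).hasTerminal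
    exact HasColimit.mk ⟨_, colimitOfDiagramTerminal CostructuredArrow.mkIdTerminal _⟩
  · have : IsEmpty (CostructuredArrow affineInclusion.op X) :=
      ⟨fun c => hX (IsRingLike.map c.hom.unop.unop.hom (isRingLike_of_ring c.left.unop.unop))⟩
    infer_instance

/-- The presheaf with exactly one section over rings, and none over other semirings. -/
def ringIndicator : CommSemiRingCat.{u}ᵒᵖᵒᵖ ⥤ Type u where
  obj X := ULift (PLift (IsRingLike X.unop.unop))
  map f := ↾fun x => ⟨⟨IsRingLike.map f.unop.unop.hom x.down.down⟩⟩

/-- Extension of presheaves from rings to semirings: the left Kan extension. -/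
abbrev presheafExtension :
    (CommRingCat.{u}ᵒᵖᵒᵖ ⥤ Type u) ⥤ (CommSemiRingCat.{u}ᵒᵖᵒᵖ ⥤ Type u) :=
  affineInclusion.op.lan

/-- On rings the indicator is a point, so `F` maps to its restriction. By adjunction the extension
maps to the indicator. -/
theorem supportedOnRings_presheafExtension (F : CommRingCat.{u}ᵒᵖᵒᵖ ⥤ Type u) :
    SupportedOnRings (presheafExtension.obj F) := by
  intro X x
  let v : F ⟶ affineInclusion.op ⋙ ringIndicator :=
    { app Y := ↾fun _ => ⟨⟨isRingLike_of_ring Y.unop.unop⟩⟩ }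
  exact (((affineInclusion.op.lanAdjunction (Type u)).homEquiv F ringIndicator).symm v |>.app
    (op X) x).down.down

/-- Restricting the extension of a presheaf gives the presheaf back. -/
def presheafExtensionIso (F : CommRingCat.{u}ᵒᵖᵒᵖ ⥤ Type u) :
    F ≅ affineInclusion.op ⋙ presheafExtension.obj F :=
  asIso (affineInclusion.op.lanUnit.app F)

theorem presheafExtension_isSheaf (F : ZarSheaf intModules.{u}) :
    Presheaf.IsSheaf (zariskiTopology natModules) (presheafExtension.obj F.obj) := by
  rw [isSheaf_iff_isSheaf_of_type]
  refine (supportedOnRings_presheafExtension F.obj).isSheaf ?_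
  rw [← isSheaf_iff_isSheaf_of_type]
  exact (Presheaf.isSheaf_of_iso_iff (presheafExtensionIso F.obj)).1 F.property

/-- Extension of Zariski sheaves from rings to semirings. -/
def sheafExtension : ZarSheaf intModules.{u} ⥤ ZarSheaf natModules.{u} :=
  ObjectProperty.lift _ (sheafToPresheaf _ _ ⋙ presheafExtension) presheafExtension_isSheaf

/-- Restriction of Zariski sheaves from semirings to rings. -/
abbrev restrictToRings : ZarSheaf natModules.{u} ⥤ ZarSheaf intModules.{u} :=
  affineInclusion.{u}.sheafPushforwardContinuous (Type u)
    (zariskiTopology intModules.{u}) (zariskiTopology natModules.{u})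

/-- Restriction to rings is left adjoint to precomposition with base change. -/
def restrictToRingsAdjunction : restrictToRings.{u} ⊣ sheafRestriction.{u} :=
  affineAdjunction.sheafPushforwardContinuous _ _

instance sheafRestriction_isRightAdjoint : sheafRestriction.{u}.IsRightAdjoint :=
  restrictToRingsAdjunction.isRightAdjoint

/-- Base change of Zariski sheaves is restriction to rings. -/
def sheafBaseChangeIso : sheafBaseChange.{u} ≅ restrictToRings.{u} :=
  (Functor.sheafAdjunctionContinuous _ _ _ _).leftAdjointUniq restrictToRingsAdjunction

/-! ### Open immersions and their images -/

section

variable {C : Type*} [Category* C] {F G H : C ⥤ Type u}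

theorem range_preimage_of_isPullback {P : C ⥤ Type u} {q₁ : P ⟶ F} {q₂ : P ⟶ H} {f : F ⟶ G}
    {x : H ⟶ G} (h : IsPullback q₁ q₂ f x) :
    Subfunctor.range q₂ = (Subfunctor.range f).preimage x := by
  ext U s
  constructor
  · rintro ⟨t, rfl⟩
    exact ⟨q₁.app U t, congr_arg (fun k => k.app U t) h.w⟩
  · rintro ⟨t, ht⟩
    have hU := h.map ((evaluation C (Type u)).obj U)
    obtain ⟨r, -, hr⟩ := Types.exists_of_isPullback hU t s ht
    exact ⟨r, hr⟩

theorem range_epi_comp (f : F ⟶ G) [Epi f] (p : G ⟶ H) :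
    Subfunctor.range (f ≫ p) = Subfunctor.range p := by
  rw [Subfunctor.range_comp, Subfunctor.range_eq_top, Subfunctor.image_top]

theorem range_comp_iso (p : F ⟶ G) (e : G ≅ H) :
    Subfunctor.range (p ≫ e.hom) = (Subfunctor.range p).preimage e.inv := by
  ext U s
  constructor
  · rintro ⟨t, rfl⟩
    exact ⟨t, by simp⟩
  · rintro ⟨t, ht⟩
    exact ⟨t, by simp [ht]⟩

theorem sheafify_preimage {C : Type*} [Category* C] (J : GrothendieckTopology C)
    {F G : Cᵒᵖ ⥤ Type u} (e : F ⟶ G) (S : Subfunctor G) :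
    (S.preimage e).sheafify J = (S.sheafify J).preimage e := by
  ext U s
  have : (S.preimage e).sieveOfSection s = S.sieveOfSection (e.app U s) := by
    ext V f
    change e.app _ (F.map f.op s) ∈ S.obj _ ↔ G.map f.op (e.app U s) ∈ S.obj _
    rw [NatTrans.naturality_apply]
  change _ ∈ J _ ↔ _ ∈ J _
  rw [this]

end

section

variable {K : Type (u + 1)} [Category.{u} K] {M : ModuleData.{u} K}

/-- This removes the pullback squares: only injectivity and the range of `f` matter, and both
transfer easily between sites. -/
theorem isOpenImmersion_iff {F G : Kᵒᵖᵒᵖ ⥤ Type u} (f : F ⟶ G) :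
    IsOpenImmersion M f ↔ Mono f ∧ ∀ (X : Kᵒᵖ) (x : yoneda.obj X ⟶ G),
      IsOpenSubsheaf M X (((Subfunctor.range f).preimage x).sheafify (zariskiTopology M)) := by
  have key {X : Kᵒᵖ} {x : yoneda.obj X ⟶ G} {P : Kᵒᵖᵒᵖ ⥤ Type u} {q₁ : P ⟶ F}
      {q₂ : P ⟶ yoneda.obj X} (h : IsPullback q₁ q₂ f x) :
      sheafImage M (fun _ : PUnit.{u + 1} => q₂) =
        ((Subfunctor.range f).preimage x).sheafify (zariskiTopology M) := by
    rw [sheafImage, iSup_const, range_preimage_of_isPullback h]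
  constructor
  · intro h
    refine ⟨?_, fun X x => ?_⟩
    · rw [NatTrans.mono_iff_mono_app]
      intro U
      rw [mono_iff_injective]
      intro a b hab
      obtain ⟨X⟩ := U
      -- Two sections with common image `x` both lift the identity of `X` to the pullback along `x`,
      -- whose projection to `X` is mono.
      let x : yoneda.obj X ⟶ G := yonedaEquiv.symm (f.app (op X) a)
      have ha : yonedaEquiv.symm a ≫ f = 𝟙 _ ≫ x := by
        apply yonedaEquiv.injective
        simp [x, yonedaEquiv_comp]
      have hb : yonedaEquiv.symm b ≫ f = 𝟙 _ ≫ x := by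
        apply yonedaEquiv.injective
        simp [x, yonedaEquiv_comp, hab]
      have hP := IsPullback.of_hasPullback f x
      have := (h X x _ _ _ hP).1
      have hl : hP.lift _ _ ha = hP.lift _ _ hb := by
        rw [← cancel_mono (pullback.snd f x), hP.lift_snd, hP.lift_snd]
      apply yonedaEquiv.symm.injective
      rw [← hP.lift_fst _ _ ha, hl, hP.lift_fst]
    · have hP := IsPullback.of_hasPullback f x
      rw [← key hP]
      exact (h X x _ _ _ hP).2
  · rintro ⟨_, h⟩ X x P q₁ q₂ hP
    refine ⟨hP.mono_snd_of_mono, ?_⟩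
    rw [key hP]
    exact h X x

theorem IsOpenImmersion.comp_iso {F G H : Kᵒᵖᵒᵖ ⥤ Type u} {f : F ⟶ G}
    (hf : IsOpenImmersion M f) (e : G ≅ H) : IsOpenImmersion M (f ≫ e.hom) := by
  rw [isOpenImmersion_iff] at hf ⊢
  have := hf.1
  refine ⟨inferInstance, fun X x => ?_⟩
  rw [range_comp_iso, ← Subfunctor.preimage_comp]
  exact hf.2 X _

instance : (IsScheme M).IsClosedUnderIsomorphisms where
  of_iso {F G} e h := by
    obtain ⟨ι, X, p, hp, hs⟩ := h
    let e' := (sheafToPresheaf _ _).mapIso e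
    refine ⟨ι, X, fun i => p i ≫ e'.hom, fun i => (hp i).comp_iso e', ?_⟩
    have : (⨆ i, Subfunctor.range (p i ≫ e'.hom)) =
        (⨆ i, Subfunctor.range (p i)).preimage e'.inv := by
      ext U s
      simp only [range_comp_iso, Subfunctor.iSup_obj, Set.mem_iUnion, Subfunctor.preimage_obj,
        Set.mem_preimage]
    rw [sheafImage] at hs ⊢
    rw [this, sheafify_preimage, hs]
    rfl

end

/-! ### Restriction of subsheaves to rings -/

/-- Restriction of a subpresheaf to rings. -/
def restrictSubfunctor {G : CommSemiRingCat.{u}ᵒᵖᵒᵖ ⥤ Type u} (S : Subfunctor G) :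
    Subfunctor (affineInclusion.op ⋙ G) where
  obj U := S.obj (affineInclusion.op.obj U)
  map f := S.map (affineInclusion.op.map f)

theorem sheafify_restrictSubfunctor {G : CommSemiRingCat.{u}ᵒᵖᵒᵖ ⥤ Type u} (S : Subfunctor G) :
    (restrictSubfunctor S).sheafify (zariskiTopology intModules) =
      restrictSubfunctor (S.sheafify (zariskiTopology natModules)) := by
  ext U s
  exact functorPullback_affineInclusion_mem_iff (Y := U.unop)
    (S := S.sieveOfSection (U := affineInclusion.op.obj U) s)

theorem SupportedOnRings.restrictSubfunctor_injective {G : CommSemiRingCat.{u}ᵒᵖᵒᵖ ⥤ Type u}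
    (hG : SupportedOnRings G) : Function.Injective (restrictSubfunctor (G := G)) := by
  intro S T h
  ext ⟨X⟩ s
  obtain ⟨Y, rfl⟩ := exists_eq_affineInclusion (hG s)
  have : (restrictSubfunctor S).obj (op Y) = (restrictSubfunctor T).obj (op Y) := by rw [h]
  exact Set.ext_iff.1 this s

theorem supportedOnRings_yoneda (Y : CommRingCat.{u}ᵒᵖ) :
    SupportedOnRings (yoneda.obj (affineInclusion.obj Y)) := by
  intro X s
  exact IsRingLike.map s.unop.hom (isRingLike_of_ring Y.unop)

instance isIso_yonedaMap (Y : CommRingCat.{u}ᵒᵖ) : IsIso (yonedaMap affineInclusion.{u} Y) := by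
  have (U : CommRingCat.{u}ᵒᵖᵒᵖ) : IsIso ((yonedaMap affineInclusion.{u} Y).app U) :=
    (isIso_iff_bijective _).2 ⟨fun _ _ h => affineInclusion.map_injective h,
      fun k => affineInclusion.map_surjective k⟩
  exact NatIso.isIso_of_isIso_app _

theorem preimage_injective_of_epi {C : Type*} [Category* C] {F G : C ⥤ Type u} (e : F ⟶ G)
    [Epi e] : Function.Injective (fun S : Subfunctor G => S.preimage e) :=
  Function.LeftInverse.injective (g := fun S => S.image e)
    fun S => Subfunctor.preimage_image_of_epi S e

/-- Sheafification commutes with restriction to rings, and a subpresheaf of the spectrum of a ring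
is determined by its sections over rings. -/
theorem sheafify_eq_sheafify_iff {Y : CommRingCat.{u}ᵒᵖ}
    (S T : Subfunctor (yoneda.obj (affineInclusion.obj Y))) :
    S.sheafify (zariskiTopology natModules) = T.sheafify (zariskiTopology natModules) ↔
      ((restrictSubfunctor S).preimage (yonedaMap affineInclusion Y)).sheafify
          (zariskiTopology intModules) =
        ((restrictSubfunctor T).preimage (yonedaMap affineInclusion Y)).sheafify
          (zariskiTopology intModules) := by
  rw [sheafify_preimage, sheafify_preimage, sheafify_restrictSubfunctor,
    sheafify_restrictSubfunctor]
  exact (((preimage_injective_of_epi _).comp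
    (supportedOnRings_yoneda Y).restrictSubfunctor_injective).eq_iff
      (a := S.sheafify _) (b := T.sheafify _)).symm

theorem restrictSubfunctor_iSup_range {ι : Type u} {F : ι → (CommSemiRingCat.{u}ᵒᵖᵒᵖ ⥤ Type u)}
    {G : CommSemiRingCat.{u}ᵒᵖᵒᵖ ⥤ Type u} (p : ∀ i, F i ⟶ G) :
    restrictSubfunctor (⨆ i, Subfunctor.range (p i)) =
      ⨆ i, Subfunctor.range (Functor.whiskerLeft affineInclusion.op (p i)) := by
  ext U s
  simp only [Subfunctor.iSup_obj, Set.mem_iUnion]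
  change s ∈ (⨆ i, Subfunctor.range (p i)).obj (affineInclusion.op.obj U) ↔ _
  simp only [Subfunctor.iSup_obj, Set.mem_iUnion]
  rfl

theorem restrictSubfunctor_iSup_range_yoneda {Y : CommRingCat.{u}ᵒᵖ} {ι : Type u}
    {V : ι → CommRingCat.{u}ᵒᵖ} (π : ∀ i, V i ⟶ Y) :
    (restrictSubfunctor (⨆ i, Subfunctor.range (yoneda.map (affineInclusion.map (π i))))).preimage
        (yonedaMap affineInclusion Y) =
      ⨆ i, Subfunctor.range (yoneda.map (π i)) := by
  rw [restrictSubfunctor_iSup_range]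
  ext U s
  simp only [Subfunctor.iSup_obj, Set.mem_iUnion, Subfunctor.preimage_obj, Set.mem_preimage]
  refine exists_congr fun i => ⟨?_, ?_⟩
  · rintro ⟨t, ht⟩
    obtain ⟨t, rfl⟩ := affineInclusion.map_surjective t
    exact ⟨t, affineInclusion.map_injective ((affineInclusion.map_comp t (π i)).trans ht)⟩
  · rintro ⟨t, rfl⟩
    exact ⟨affineInclusion.map t, (affineInclusion.map_comp t (π i)).symm⟩

/-- Affine opens of the spectrum of a ring are spectra of rings, so the same families define the
open subsheaves on both sites. -/
theorem isOpenSubsheaf_affineInclusion_iff {Y : CommRingCat.{u}ᵒᵖ}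
    (T : Subfunctor (yoneda.obj (affineInclusion.obj Y))) :
    IsOpenSubsheaf natModules (affineInclusion.obj Y) (T.sheafify (zariskiTopology natModules)) ↔
      IsOpenSubsheaf intModules Y (((restrictSubfunctor T).preimage
        (yonedaMap affineInclusion Y)).sheafify (zariskiTopology intModules)) := by
  constructor
  · rintro ⟨ι, U, p, hp, h⟩
    choose V hV using fun i => exists_eq_of_hom_affineInclusion (p i)
    obtain rfl : U = fun i => affineInclusion.obj (V i) := funext hV
    choose π hπ using fun i => affineInclusion.map_surjective (p i)
    obtain rfl : (fun i => affineInclusion.map (π i)) = p := funext hπ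
    refine ⟨ι, V, π, fun i => (isAffineOpen_affineInclusion_map _).1 (hp i), ?_⟩
    rw [sheafImage, sheafify_eq_sheafify_iff] at h
    rw [h, restrictSubfunctor_iSup_range_yoneda, sheafImage]
  · rintro ⟨ι, V, π, hπ, h⟩
    refine ⟨ι, fun i => affineInclusion.obj (V i), fun i => affineInclusion.map (π i),
      fun i => (isAffineOpen_affineInclusion_map _).2 (hπ i), ?_⟩
    rw [sheafImage, sheafify_eq_sheafify_iff, h, restrictSubfunctor_iSup_range_yoneda, sheafImage]

/-! ### Transfer of open immersions -/

/-- The morphism from an affine `ℤ`-scheme, seen as an `ℕ`-scheme, to a presheaf `G` determined by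
a section of `G` over a ring. -/
def extendHom {Y : CommRingCat.{u}ᵒᵖ} {G : CommSemiRingCat.{u}ᵒᵖᵒᵖ ⥤ Type u}
    (y : yoneda.obj Y ⟶ affineInclusion.op ⋙ G) : yoneda.obj (affineInclusion.obj Y) ⟶ G :=
  yonedaEquiv.symm (show G.obj (op (affineInclusion.obj Y)) from
    yonedaEquiv (F := affineInclusion.op ⋙ G) y)

theorem yonedaMap_comp_extendHom {Y : CommRingCat.{u}ᵒᵖ} {G : CommSemiRingCat.{u}ᵒᵖᵒᵖ ⥤ Type u}
    (y : yoneda.obj Y ⟶ affineInclusion.op ⋙ G) :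
    yonedaMap affineInclusion Y ≫ Functor.whiskerLeft affineInclusion.op (extendHom y) = y := by
  apply yonedaEquiv.injective
  change G.map (affineInclusion.map (𝟙 Y)).op (yonedaEquiv (F := affineInclusion.op ⋙ G) y) =
    yonedaEquiv (F := affineInclusion.op ⋙ G) y
  rw [CategoryTheory.Functor.map_id, op_id, CategoryTheory.Functor.map_id]
  rfl

/-- A test morphism from an affine ℤ-scheme to the restriction of `G` extends to one into `G`. The
isomorphism `e` represents the restriction of `X`, which need not be the spectrum of a ring. -/
theorem IsOpenImmersion.restrict {X : CommSemiRingCat.{u}ᵒᵖ}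
    {G : CommSemiRingCat.{u}ᵒᵖᵒᵖ ⥤ Type u} {p : yoneda.obj X ⟶ G}
    (hp : IsOpenImmersion natModules p) {X' : CommRingCat.{u}ᵒᵖ}
    (e : yoneda.obj X' ≅ affineInclusion.op ⋙ yoneda.obj X) :
    IsOpenImmersion intModules (e.hom ≫ Functor.whiskerLeft affineInclusion.op p) := by
  rw [isOpenImmersion_iff] at hp ⊢
  have := hp.1
  have : Mono (Functor.whiskerLeft affineInclusion.op p) :=
    inferInstanceAs (Mono (((Functor.whiskeringLeft _ _ _).obj affineInclusion.op).map p))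
  refine ⟨inferInstance, fun Y y => ?_⟩
  have := (isOpenSubsheaf_affineInclusion_iff _).1 (hp.2 _ (extendHom y))
  rw [range_epi_comp, ← yonedaMap_comp_extendHom y]
  exact this

theorem IsOpenImmersion.extend {X : CommRingCat.{u}ᵒᵖ}
    {G : CommSemiRingCat.{u}ᵒᵖᵒᵖ ⥤ Type u} (hG : SupportedOnRings G)
    {p : yoneda.obj (affineInclusion.obj X) ⟶ G}
    (hp : IsOpenImmersion intModules
      (yonedaMap affineInclusion X ≫ Functor.whiskerLeft affineInclusion.op p)) :
    IsOpenImmersion natModules p := by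
  rw [isOpenImmersion_iff] at hp ⊢
  constructor
  · have := hp.1
    have : Mono (Functor.whiskerLeft affineInclusion.op p) := by
      have := mono_comp (inv (yonedaMap affineInclusion X)) (yonedaMap affineInclusion X ≫
        Functor.whiskerLeft affineInclusion.op p)
      rwa [IsIso.inv_hom_id_assoc] at this
    rw [NatTrans.mono_iff_mono_app] at this ⊢
    rintro ⟨Z⟩
    rw [mono_iff_injective]
    intro a b hab
    obtain ⟨Z, rfl⟩ := exists_eq_of_hom_affineInclusion a
    exact (mono_iff_injective _).1 (this (op Z)) hab
  · intro Z x
    -- A test morphism is a section of `G`, so its source must be the spectrum of a ring.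
    obtain ⟨Y, rfl⟩ := exists_eq_affineInclusion (hG (yonedaEquiv x))
    rw [isOpenSubsheaf_affineInclusion_iff]
    have := hp.2 Y (yonedaMap affineInclusion Y ≫ Functor.whiskerLeft affineInclusion.op x)
    rw [range_epi_comp] at this
    exact this

/-! ### Schemes -/

/-- The restriction to rings of an affine `ℕ`-scheme is the base change of the scheme. -/
def yonedaBaseChangeIso (X : CommSemiRingCat.{u}ᵒᵖ) :
    yoneda.obj (affineBaseChange.obj X) ≅ affineInclusion.op ⋙ yoneda.obj X :=
  (affineAdjunction.representableBy X).toIso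

theorem isScheme_restrictToRings {F : ZarSheaf natModules.{u}} (hF : IsScheme natModules F) :
    IsScheme intModules (restrictToRings.obj F) := by
  obtain ⟨ι, X, p, hp, hs⟩ := hF
  refine ⟨ι, fun i => affineBaseChange.obj (X i),
    fun i => (yonedaBaseChangeIso (X i)).hom ≫ Functor.whiskerLeft affineInclusion.op (p i),
    fun i => (hp i).restrict _, ?_⟩
  rw [sheafImage] at hs
  have h : (⨆ i, Subfunctor.range ((yonedaBaseChangeIso (X i)).hom ≫
      Functor.whiskerLeft affineInclusion.op (p i))) =
        restrictSubfunctor (⨆ i, Subfunctor.range (p i)) := by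
    rw [restrictSubfunctor_iSup_range]
    exact iSup_congr fun i => range_epi_comp _ _
  have h' := sheafify_restrictSubfunctor (⨆ i, Subfunctor.range (p i))
  rw [hs, ← h] at h'
  exact h'

theorem isScheme_sheafBaseChange (X : NatSch.{u}) :
    IsScheme intModules (sheafBaseChange.obj X.obj) :=
  (IsScheme intModules).prop_of_iso (sheafBaseChangeIso.app X.obj).symm
    (isScheme_restrictToRings X.property)

theorem isScheme_sheafExtension (F : IntSch.{u}) :
    IsScheme natModules (sheafExtension.obj F.obj) := by
  obtain ⟨ι, X, p, hp, hs⟩ := F.property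
  let G := presheafExtension.obj F.obj.obj
  have hG : SupportedOnRings G := supportedOnRings_presheafExtension _
  let e : F.obj.obj ≅ affineInclusion.op ⋙ G := presheafExtensionIso F.obj.obj
  let q (i : ι) : yoneda.obj (affineInclusion.obj (X i)) ⟶ G :=
    extendHom (p i ≫ e.hom)
  have hq (i : ι) : yonedaMap affineInclusion (X i) ≫
      Functor.whiskerLeft affineInclusion.op (q i) = p i ≫ e.hom :=
    yonedaMap_comp_extendHom _
  refine ⟨ι, fun i => affineInclusion.obj (X i), q, fun i => ?_, ?_⟩
  · refine IsOpenImmersion.extend hG ?_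
    rw [hq]
    exact (hp i).comp_iso e
  -- Joint local surjectivity need only be checked over rings, where it is that of the original
  -- atlas.
  · apply hG.restrictSubfunctor_injective
    change restrictSubfunctor ((⨆ i, Subfunctor.range (q i)).sheafify
      (zariskiTopology natModules)) = restrictSubfunctor ⊤
    rw [← sheafify_restrictSubfunctor, restrictSubfunctor_iSup_range]
    have (i : ι) : Subfunctor.range (Functor.whiskerLeft affineInclusion.op (q i)) =
        (Subfunctor.range (p i)).preimage e.inv := by
      rw [← range_comp_iso, ← hq, range_epi_comp]
    have : (⨆ i, Subfunctor.range (Functor.whiskerLeft affineInclusion.op (q i))) =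
        (⨆ i, Subfunctor.range (p i)).preimage e.inv := by
      ext U s
      simp only [this, Subfunctor.iSup_obj, Set.mem_iUnion, Subfunctor.preimage_obj,
        Set.mem_preimage]
    rw [this, sheafify_preimage]
    rw [sheafImage] at hs
    rw [hs]
    rfl

/-- Extension of `ℤ`-schemes to `ℕ`-schemes. -/
def schemeExtension : IntSch.{u} ⥤ NatSch.{u} :=
  (IsScheme natModules).lift ((IsScheme intModules).ι ⋙ sheafExtension) isScheme_sheafExtension

/-- Extension of `ℤ`-schemes is left adjoint to base change. -/
def schemeExtensionAdjunction :
    schemeExtension.{u} ⊣ schemeBaseChange.{u} isScheme_sheafBaseChange :=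
  -- Schemes are full in presheaves on both sides, so the presheaf adjunction restricts. The left
  -- functor is the Kan extension on the nose; the right one is identified with restriction to
  -- rings.
  (affineInclusion.op.lanAdjunction (Type u)).restrictFullyFaithful
    (iC := (IsScheme intModules).ι ⋙ sheafToPresheaf _ _)
    (iD := (IsScheme natModules).ι ⋙ sheafToPresheaf _ _)
    ((ObjectProperty.fullyFaithfulι _).comp (fullyFaithfulSheafToPresheaf _ _))
    ((ObjectProperty.fullyFaithfulι _).comp (fullyFaithfulSheafToPresheaf _ _))
    (Iso.refl _)
    (Functor.isoWhiskerLeft (IsScheme natModules).ι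
      (Functor.isoWhiskerRight sheafBaseChangeIso.symm (sheafToPresheaf _ _)))

/-- The extension functor from `ℤ`-schemes to `ℕ`-schemes is fully faithful. -/
def schemeExtensionFullyFaithful : schemeExtension.{u}.FullyFaithful :=
  Functor.FullyFaithful.ofCompFaithful (G := (IsScheme natModules).ι ⋙ sheafToPresheaf _ _)
    (((ObjectProperty.fullyFaithfulι _).comp (fullyFaithfulSheafToPresheaf _ _)).comp
      (affineInclusion.op.lanAdjunction (Type u)).fullyFaithfulLOfIsIsoUnit)

end RelScheme

end

/-- The base change functor `- ⊗_ℕ ℤ` from `ℕ`-schemes to `ℤ`-schemes is well defined (base change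
of affine schemes is continuous for the Zariski topologies, restriction of sheaves along it has
a left adjoint, and this left adjoint preserves schemes), and it has a left adjoint which is
fully faithful. -/
theorem mainTheorem5 :
    ∃ (_ : RelScheme.AffineBaseChangeContinuous.{u})
      (_ : RelScheme.sheafRestriction.{u}.IsRightAdjoint)
      (h : ∀ X : RelScheme.NatSch.{u},
        RelScheme.IsScheme RelScheme.intModules.{u} (RelScheme.sheafBaseChange.{u}.obj X.obj)),
      ∃ L : RelScheme.IntSch.{u} ⥤ RelScheme.NatSch.{u},
        Nonempty (L ⊣ RelScheme.schemeBaseChange.{u} h) ∧ L.Full ∧ L.Faithful :=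
  ⟨RelScheme.affineBaseChange_isContinuous, RelScheme.sheafRestriction_isRightAdjoint,
    RelScheme.isScheme_sheafBaseChange, RelScheme.schemeExtension,
    ⟨RelScheme.schemeExtensionAdjunction⟩, RelScheme.schemeExtensionFullyFaithful.full,
    RelScheme.schemeExtensionFullyFaithful.faithful⟩
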